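/- Let $\mathbb{O}_{\mathbb{C}}=\mathbb{O}_{\mathbb{R}}\otimes_{\mathbb{R}}\mathbb{C}$ be the octonion algebra over $\mathbb{C}$, where $\mathbb{O}_{\mathbb{R}}$ is the classical algebra of real octonions, with the $\mathbb{C}$-linear conjugation $\overline{o\otimes z}=\bar o\otimes z$; complex numbers are regarded as elements of $\mathbb{O}_{\mathbb{C}}$ via $z\mapsto 1\otimes z$. Let $$\mathrm{Herm}(3,\mathbb{O}_{\mathbb{C}})=\{A\in M(3,\mathbb{O}_{\mathbb{C}}) : \bar A^{T}=A\},$$ and let $\mathcal{J}_3(\mathbb{O}_{\mathbb{C}})$ be this complex vector space with the product $A\circ B=\tfrac12(AB+BA)$. Let $\mathrm{F}_4$ be the group of all $\mathbb{C}$-linear bijections $g$ of $\mathrm{Herm}(3,\mathbb{O}_{\mathbb{C}})$ such that $g(A\circ B)=gA\circ gB$ for all $A,B$, and let $$\mathcal{A}=\{A\in \mathrm{Herm}(3,\mathbb{O}_{\mathbb{C}}) : A^2=0,\ \operatorname{tr}A=0,\ A\neq 0\}.$$ **Theorem.** The group $\mathrm{F}_4$ maps $\mathcal{A}$ to itself and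 acts transitively on it: for all $A,B\in\mathcal{A}$ there is $g\in \mathrm{F}_4$ with $gA=B$. Moreover, the matrix $$C=\begin{pmatrix} i & 1 & 0\\ 1 & -i & 0\\ 0&0&0\end{pmatrix}$$ belongs to $\mathcal{A}$, and for every $A\in\mathcal{A}$ there is $g\in \mathrm{F}_4$ such that $gA=C$. -/

import Mathlib

open scoped Quaternion Matrix

/-- The (Cayley-Dickson) octonion algebra over a commutative ring `R`: pairs of
quaternions `(a, b)` with `(a, b) (c, d) = (a c - d̄ b, d a + b c̄)` and conjugation
`(a, b) ↦ (ā, -b)`. For `R = ℝ` this is the classical algebra of real octonions; the structure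
constants are integers, so for `R = ℂ` it is its complexification, the octonion algebra over `ℂ`.
The conjugation is `R`-linear: for `R = ℂ` it does not conjugate complex coefficients. -/
@[ext]
structure Octonion (R : Type*) [CommRing R] where
  fst : ℍ[R]
  snd : ℍ[R]

namespace Octonion

variable {R : Type*} [CommRing R]

instance : Zero (Octonion R) := ⟨⟨0, 0⟩⟩
instance : One (Octonion R) := ⟨⟨1, 0⟩⟩
instance : Add (Octonion R) := ⟨fun x y => ⟨x.fst + y.fst, x.snd + y.snd⟩⟩
instance : Neg (Octonion R) := ⟨fun x => ⟨-x.fst, -x.snd⟩⟩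
instance : Sub (Octonion R) := ⟨fun x y => ⟨x.fst - y.fst, x.snd - y.snd⟩⟩
instance : SMul R (Octonion R) := ⟨fun r x => ⟨r • x.fst, r • x.snd⟩⟩
instance : Mul (Octonion R) :=
  ⟨fun x y => ⟨x.fst * y.fst - star y.snd * x.snd, y.snd * x.fst + x.snd * star y.fst⟩⟩
instance : Star (Octonion R) := ⟨fun x => ⟨star x.fst, -x.snd⟩⟩

@[simp] theorem zero_fst : (0 : Octonion R).fst = 0 := rfl
@[simp] theorem zero_snd : (0 : Octonion R).snd = 0 := rfl
@[simp] theorem one_fst : (1 : Octonion R).fst = 1 := rfl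
@[simp] theorem one_snd : (1 : Octonion R).snd = 0 := rfl
@[simp] theorem add_fst (x y : Octonion R) : (x + y).fst = x.fst + y.fst := rfl
@[simp] theorem add_snd (x y : Octonion R) : (x + y).snd = x.snd + y.snd := rfl
@[simp] theorem neg_fst (x : Octonion R) : (-x).fst = -x.fst := rfl
@[simp] theorem neg_snd (x : Octonion R) : (-x).snd = -x.snd := rfl
@[simp] theorem sub_fst (x y : Octonion R) : (x - y).fst = x.fst - y.fst := rfl
@[simp] theorem sub_snd (x y : Octonion R) : (x - y).snd = x.snd - y.snd := rfl
@[simp] theorem smul_fst (r : R) (x : Octonion R) : (r • x).fst = r • x.fst := rfl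
@[simp] theorem smul_snd (r : R) (x : Octonion R) : (r • x).snd = r • x.snd := rfl
@[simp] theorem mul_fst (x y : Octonion R) :
    (x * y).fst = x.fst * y.fst - star y.snd * x.snd := rfl
@[simp] theorem mul_snd (x y : Octonion R) :
    (x * y).snd = y.snd * x.fst + x.snd * star y.fst := rfl
@[simp] theorem star_fst (x : Octonion R) : (star x).fst = star x.fst := rfl
@[simp] theorem star_snd (x : Octonion R) : (star x).snd = -x.snd := rfl

instance : AddCommGroup (Octonion R) where
  add_assoc x y z := by ext1 <;> simp [add_assoc]
  zero_add x := by ext1 <;> simp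
  add_zero x := by ext1 <;> simp
  add_comm x y := by ext1 <;> simp [add_comm]
  neg_add_cancel x := by ext1 <;> simp
  sub_eq_add_neg x y := by ext1 <;> simp [sub_eq_add_neg]
  nsmul := nsmulRec
  zsmul := zsmulRec

instance : NonAssocRing (Octonion R) where
  left_distrib x y z := by ext1 <;> simp [mul_add, add_mul] <;> abel
  right_distrib x y z := by ext1 <;> simp [mul_add, add_mul] <;> abel
  zero_mul x := by ext1 <;> simp
  mul_zero x := by ext1 <;> simp
  one_mul x := by ext1 <;> simp
  mul_one x := by ext1 <;> simp

instance : Module R (Octonion R) where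
  one_smul x := by ext1 <;> simp
  mul_smul r s x := by ext1 <;> simp [mul_smul]
  smul_zero r := by ext1 <;> simp
  smul_add r x y := by ext1 <;> simp
  add_smul r s x := by ext1 <;> simp [add_smul]
  zero_smul x := by ext1 <;> simp

instance : StarRing (Octonion R) where
  star_involutive x := by ext1 <;> simp
  star_mul x y := by ext1 <;> simp [sub_eq_add_neg]
  star_add x y := by ext1 <;> simp [add_comm]

theorem star_smul' (r : R) (x : Octonion R) : star (r • x) = r • star x := by
  ext1 <;> simp

end Octonion

/-- The octonion algebra over the complex numbers. -/
abbrev OctonionC : Type := Octonion ℂ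

/-- The complex vector space `Herm(3, 𝕆_ℂ)` of hermitian octonionic `3 × 3` matrices. -/
def Herm3 : Submodule ℂ (Matrix (Fin 3) (Fin 3) OctonionC) where
  carrier := {A | Aᴴ = A}
  add_mem' {A B} hA hB := by
    simp only [Set.mem_ofPred_eq] at *
    rw [Matrix.conjTranspose_add, hA, hB]
  zero_mem' := by simp
  smul_mem' c A hA := by
    simp only [Set.mem_ofPred_eq] at *
    ext1 i j
    rw [Matrix.conjTranspose_apply, Matrix.smul_apply, Octonion.star_smul',
      ← Matrix.conjTranspose_apply, hA, Matrix.smul_apply]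

theorem jordan_mem_Herm3 (A B : Herm3) :
    (1 / 2 : ℂ) • ((A : Matrix (Fin 3) (Fin 3) OctonionC) * B + B * A) ∈ Herm3 := by
  apply Herm3.smul_mem
  have hA : (A : Matrix (Fin 3) (Fin 3) OctonionC)ᴴ = A := A.2
  have hB : (B : Matrix (Fin 3) (Fin 3) OctonionC)ᴴ = B := B.2
  have key : ∀ X Y : Matrix (Fin 3) (Fin 3) OctonionC, (X * Y)ᴴ = Yᴴ * Xᴴ := by
    intro X Y
    ext1 i j
    simp only [Matrix.conjTranspose_apply, Matrix.mul_apply, star_sum, star_mul]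
  change (_ : Matrix (Fin 3) (Fin 3) OctonionC)ᴴ = _
  rw [Matrix.conjTranspose_add, key, key, hA, hB, add_comm]

/-- The product `A ∘ B = (AB + BA) / 2` of the complex exceptional Jordan algebra
`J₃(𝕆_ℂ) = (Herm(3, 𝕆_ℂ), ∘)`. -/
noncomputable def jordanMul (A B : Herm3) : Herm3 :=
  ⟨(1 / 2 : ℂ) • ((A : Matrix (Fin 3) (Fin 3) OctonionC) * B + B * A), jordan_mem_Herm3 A B⟩

/-- The complex group `F₄`: the group of all `ℂ`-linear automorphisms of the complex exceptional
Jordan algebra `J₃(𝕆_ℂ)`. -/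
def F4 : Subgroup (Herm3 ≃ₗ[ℂ] Herm3) where
  carrier := {g | ∀ A B : Herm3, g (jordanMul A B) = jordanMul (g A) (g B)}
  mul_mem' {g h} hg hh A B := by
    rw [LinearEquiv.mul_apply, hh, hg]
    rfl
  one_mem' _ _ := rfl
  inv_mem' {g} hg A B := by
    apply g.injective
    rw [hg]
    change g (g.symm _) = jordanMul (g (g.symm A)) (g (g.symm B))
    simp only [LinearEquiv.apply_symm_apply]

/-- The cone `𝒜 = {A ∈ Herm(3, 𝕆_ℂ) | A² = 0, tr A = 0, A ≠ 0}`. -/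
def coneOP : Set Herm3 :=
  {A | (A : Matrix (Fin 3) (Fin 3) OctonionC) * A = 0 ∧
    Matrix.trace (A : Matrix (Fin 3) (Fin 3) OctonionC) = 0 ∧ A ≠ 0}

/-- The canonical element; a complex number `z` is the octonion `z • 1`. -/
noncomputable def canonicalElement : Herm3 :=
  ⟨!![Complex.I • 1, 1, 0;
      1, -(Complex.I • 1), 0;
      0, 0, 0], by
    change (_ : Matrix (Fin 3) (Fin 3) OctonionC)ᴴ = _
    ext1 i j
    fin_cases i <;> fin_cases j <;> simp [Octonion.star_smul']⟩

/-! Invariance of the cone: in hermitian matrices `A² = 0` already forces trace zero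
(`trace_eq_zero_of_mul_self_eq_zero`), and `A²` is the Jordan square, which automorphisms respect.

Transitivity uses two explicit families in `F4`. Twists by octonions of norm 1 are automorphisms by
the Moufang identities (`twist_square`). Congruences `P A Pᵀ` by complex orthogonal `P` are
automorphisms because complex scalars associate with everything (`congruenceMatrix_mul`); the
transpose is unconjugated since octonion conjugation is `ℂ`-linear.

Rotations and twists make the diagonal nowhere zero. Then the off-diagonal norms, being products of
diagonal entries, are nonzero, and suitable twists turn all entries into complex scalars
(`exists_sameOrbit_scalar`). The resulting matrix is `v vᵀ` with `v` an isotropic vector in `ℂ³`,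
and `C = w wᵀ` with `w` isotropic; an orthogonal reflection carries `v` to `w`. -/

namespace Octonion

/-! ### Octonion identities over a commutative ring -/

section Ring

variable {R : Type*} [CommRing R]

theorem ext_components {x y : Octonion R}
    (h₀ : x.fst.re = y.fst.re) (h₁ : x.fst.imI = y.fst.imI) (h₂ : x.fst.imJ = y.fst.imJ)
    (h₃ : x.fst.imK = y.fst.imK) (h₄ : x.snd.re = y.snd.re) (h₅ : x.snd.imI = y.snd.imI)
    (h₆ : x.snd.imJ = y.snd.imJ) (h₇ : x.snd.imK = y.snd.imK) : x = y := by
  ext <;> assumption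

instance : IsScalarTower R (Octonion R) (Octonion R) where
  smul_assoc r x y := by ext1 <;> simp [smul_sub]

instance : SMulCommClass R (Octonion R) (Octonion R) where
  smul_comm r x y := by ext1 <;> simp [smul_sub]

/-- The real part of an octonion. -/
def re (x : Octonion R) : R := x.fst.re

/-- The quadratic norm form of the octonions. -/
def normSq (x : Octonion R) : R :=
  x.fst.re ^ 2 + x.fst.imI ^ 2 + x.fst.imJ ^ 2 + x.fst.imK ^ 2 +
    (x.snd.re ^ 2 + x.snd.imI ^ 2 + x.snd.imJ ^ 2 + x.snd.imK ^ 2)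

@[simp] theorem re_add (x y : Octonion R) : (x + y).re = x.re + y.re := by simp [re]
@[simp] theorem re_smul (r : R) (x : Octonion R) : (r • x).re = r * x.re := by simp [re]
@[simp] theorem re_one : (1 : Octonion R).re = 1 := by simp [re]
@[simp] theorem re_neg (x : Octonion R) : (-x).re = -x.re := by simp [re]
@[simp] theorem re_star (x : Octonion R) : (star x).re = x.re := by simp [re]

@[simp] theorem normSq_star (x : Octonion R) : normSq (star x) = normSq x := by
  simp [normSq]

@[simp] theorem normSq_neg (x : Octonion R) : normSq (-x) = normSq x := by
  simp [normSq]

@[simp] theorem normSq_smul (r : R) (x : Octonion R) : normSq (r • x) = r ^ 2 * normSq x := by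
  simp only [normSq, smul_fst, smul_snd, Quaternion.re_smul, Quaternion.imI_smul,
    Quaternion.imJ_smul, Quaternion.imK_smul, smul_eq_mul]
  ring

@[simp] theorem normSq_one : normSq (1 : Octonion R) = 1 := by
  simp [normSq]

theorem mul_star_self' (x : Octonion R) : x * star x = normSq x • (1 : Octonion R) := by
  apply ext_components <;> simp [normSq] <;> ring

theorem star_mul_self' (x : Octonion R) : star x * x = normSq x • (1 : Octonion R) := by
  simpa using mul_star_self' (star x)

theorem normSq_mul (x y : Octonion R) : normSq (x * y) = normSq x * normSq y := by
  simp [normSq]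
  ring

theorem re_mul_assoc (x y z : Octonion R) : ((x * y) * z).re = (x * (y * z)).re := by
  simp [re]
  ring

theorem re_mul_comm (x y : Octonion R) : (x * y).re = (y * x).re := by
  simp [re]
  ring

theorem star_mul_mul_cancel (x y : Octonion R) : star x * (x * y) = normSq x • y := by
  apply ext_components <;> simp [normSq] <;> ring

theorem mul_mul_star_cancel (x y : Octonion R) : (y * x) * star x = normSq x • y := by
  apply star_injective
  simpa [star_smul'] using star_mul_mul_cancel (star x) (star y)

theorem mul_mul_self_comm (x y : Octonion R) : (x * y) * x = x * (y * x) := by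
  apply ext_components <;> simp <;> ring

set_option maxHeartbeats 2000000 in
theorem moufang_left (u x y : Octonion R) : ((u * x) * u) * y = u * (x * (u * y)) := by
  apply ext_components <;>
    simp only [mul_fst, mul_snd, Quaternion.re_mul, Quaternion.imI_mul, Quaternion.imJ_mul,
      Quaternion.imK_mul, Quaternion.re_sub, Quaternion.imI_sub, Quaternion.imJ_sub,
      Quaternion.imK_sub, Quaternion.re_add, Quaternion.imI_add, Quaternion.imJ_add,
      Quaternion.imK_add, Quaternion.re_star, Quaternion.imI_star, Quaternion.imJ_star,
      Quaternion.imK_star] <;>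
    ring

set_option maxHeartbeats 2000000 in
theorem moufang_middle (u x y : Octonion R) : (u * x) * (y * u) = (u * (x * y)) * u := by
  apply ext_components <;>
    simp only [mul_fst, mul_snd, Quaternion.re_mul, Quaternion.imI_mul, Quaternion.imJ_mul,
      Quaternion.imK_mul, Quaternion.re_sub, Quaternion.imI_sub, Quaternion.imJ_sub,
      Quaternion.imK_sub, Quaternion.re_add, Quaternion.imI_add, Quaternion.imJ_add,
      Quaternion.imK_add, Quaternion.re_star, Quaternion.imI_star, Quaternion.imJ_star,
      Quaternion.imK_star] <;>
    ring

end Ring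

end Octonion

open Octonion

/-! ### Coordinates on hermitian matrices and the Jordan square -/

theorem Octonion.eq_smul_one_of_star_eq {x : OctonionC} (h : star x = x) :
    x = x.re • (1 : OctonionC) := by
  rw [Octonion.ext_iff, Quaternion.ext_iff, Quaternion.ext_iff] at h
  simp [neg_eq_iff_add_eq_zero, ← two_mul] at h
  apply ext_components <;> simp [re, h]

theorem Octonion.smul_one_injective {r s : ℂ} (h : r • (1 : OctonionC) = s • 1) : r = s := by
  simpa using congrArg re h

/-- The hermitian matrix with diagonal `a, b, c` and off-diagonal entries `x, y, z` at the
positions `(1, 2)`, `(2, 0)`, `(0, 1)`. -/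
def hermMatrix (a b c : ℂ) (x y z : OctonionC) : Matrix (Fin 3) (Fin 3) OctonionC :=
  !![a • 1, z, star y; star z, b • 1, x; y, star x, c • 1]

theorem hermMatrix_mem (a b c : ℂ) (x y z : OctonionC) : hermMatrix a b c x y z ∈ Herm3 := by
  change (_ : Matrix (Fin 3) (Fin 3) OctonionC)ᴴ = _
  ext1 i j
  fin_cases i <;> fin_cases j <;> simp [hermMatrix, Octonion.star_smul']

/-- `hermMatrix` as an element of `Herm3`. -/
def herm (a b c : ℂ) (x y z : OctonionC) : Herm3 :=
  ⟨hermMatrix a b c x y z, hermMatrix_mem a b c x y z⟩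

theorem exists_eq_herm (A : Herm3) : ∃ a b c x y z, A = herm a b c x y z := by
  have h : ∀ i j, star ((A : Matrix (Fin 3) (Fin 3) OctonionC) j i) = A.1 i j := fun i j =>
    congrFun (congrFun (show (A : Matrix (Fin 3) (Fin 3) OctonionC)ᴴ = A from A.2) i) j
  refine ⟨(A.1 0 0).re, (A.1 1 1).re, (A.1 2 2).re, A.1 1 2, A.1 2 0, A.1 0 1, ?_⟩
  apply Subtype.ext
  ext1 i j
  fin_cases i <;> fin_cases j <;>
    simp [herm, hermMatrix, h, ← eq_smul_one_of_star_eq]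

theorem herm_injective {a b c a' b' c' : ℂ} {x y z x' y' z' : OctonionC}
    (h : herm a b c x y z = herm a' b' c' x' y' z') :
    a = a' ∧ b = b' ∧ c = c' ∧ x = x' ∧ y = y' ∧ z = z' := by
  have h' : ∀ i j, hermMatrix a b c x y z i j = hermMatrix a' b' c' x' y' z' i j := fun i j =>
    congrFun (congrFun (congrArg Subtype.val h) i) j
  exact ⟨smul_one_injective (h' 0 0), smul_one_injective (h' 1 1), smul_one_injective (h' 2 2),
    h' 1 2, h' 2 0, h' 0 1⟩

theorem hermMatrix_mul_self (a b c : ℂ) (x y z : OctonionC) :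
    hermMatrix a b c x y z * hermMatrix a b c x y z =
      hermMatrix (a ^ 2 + normSq z + normSq y) (b ^ 2 + normSq x + normSq z)
        (c ^ 2 + normSq y + normSq x) ((b + c) • x + star (y * z)) ((c + a) • y + star (z * x))
        ((a + b) • z + star (x * y)) := by
  ext1 i j
  fin_cases i <;> fin_cases j <;>
    simp [hermMatrix, Matrix.mul_apply, Fin.sum_univ_three, mul_star_self', star_mul_self',
      Octonion.star_smul'] <;>
    module

theorem jordanMul_self_val (A : Herm3) :
    (jordanMul A A : Matrix (Fin 3) (Fin 3) OctonionC) = A * A := by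
  change (1 / 2 : ℂ) • ((A : Matrix (Fin 3) (Fin 3) OctonionC) * A + A * A) = A * A
  module

/-- Squares determine the product, so a linear map need only be tested on squares. -/
theorem jordanMul_polarization (A B : Herm3) :
    jordanMul A B = (1 / 2 : ℂ) •
      (jordanMul (A + B) (A + B) - jordanMul A A - jordanMul B B) := by
  apply Subtype.ext
  simp only [Submodule.coe_smul, Submodule.coe_sub, jordanMul_self_val, Submodule.coe_add]
  change (1 / 2 : ℂ) • ((A : Matrix (Fin 3) (Fin 3) OctonionC) * B + B * A) = _
  rw [mul_add, add_mul, add_mul]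
  module

/-- Two linear endomorphisms that are inverse to each other, the first of which respects squares,
give an automorphism of the Jordan algebra. -/
theorem exists_mem_F4 (f f' : Herm3 →ₗ[ℂ] Herm3) (h : ∀ A, f' (f A) = A) (h' : ∀ A, f (f' A) = A)
    (hsq : ∀ A, f (jordanMul A A) = jordanMul (f A) (f A)) : ∃ g ∈ F4, ∀ A, g A = f A := by
  refine ⟨LinearEquiv.ofLinearMap f f' (LinearMap.ext h') (LinearMap.ext h), fun A B => ?_,
    fun A => rfl⟩
  change f _ = jordanMul (f A) (f B)
  rw [jordanMul_polarization A, jordanMul_polarization (f A)]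
  simp only [map_smul, map_sub, hsq, map_add]

theorem herm_mem_coneOP {a b c : ℂ} {x y z : OctonionC} :
    herm a b c x y z ∈ coneOP ↔
      (hermMatrix a b c x y z * hermMatrix a b c x y z = 0 ∧ a + b + c = 0 ∧
        herm a b c x y z ≠ 0) := by
  have : Matrix.trace (hermMatrix a b c x y z) = (a + b + c) • (1 : OctonionC) := by
    simp [Matrix.trace, Fin.sum_univ_three, hermMatrix, add_smul]
  have h2 : Matrix.trace (hermMatrix a b c x y z) = 0 ↔ a + b + c = 0 := by
    rw [this]
    exact ⟨fun h => smul_one_injective (by rw [h, zero_smul]), fun h => by rw [h, zero_smul]⟩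
  rw [← h2]
  rfl

theorem hermMatrix_zero : hermMatrix 0 0 0 0 0 0 = 0 := by
  ext1 i j
  fin_cases i <;> fin_cases j <;> simp [hermMatrix]

theorem hermMatrix_mul_self_eq_zero {a b c : ℂ} {x y z : OctonionC}
    (h : hermMatrix a b c x y z * hermMatrix a b c x y z = 0) :
    a ^ 2 + normSq z + normSq y = 0 ∧ b ^ 2 + normSq x + normSq z = 0 ∧
      c ^ 2 + normSq y + normSq x = 0 ∧ (b + c) • x + star (y * z) = 0 ∧
      (c + a) • y + star (z * x) = 0 ∧ (a + b) • z + star (x * y) = 0 := by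
  rw [hermMatrix_mul_self, ← hermMatrix_zero] at h
  exact herm_injective (Subtype.ext h)

/-! ### Square zero forces trace zero -/

theorem smul_normSq_eq {r : ℂ} {x y z : OctonionC} (h : r • x + star (y * z) = 0) :
    r * normSq x = - (x * (y * z)).re := by
  have h1 : y * z = - (r • star x) := by
    have := congrArg star (eq_neg_of_add_eq_zero_right h)
    simpa [Octonion.star_smul'] using this
  rw [h1, mul_neg, mul_smul_comm, mul_star_self']
  simp

/-- Since `Re (x(yz))` is cyclic, `(b+c)N(x)`, `(c+a)N(y)` and `(a+b)N(z)` agree. If `N(x) ≠ 0`,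
comparison with `(a+b)²N(z) = N(x)N(y)` gives `N(y) = (a+b)(b+c)`, and the diagonal equations then
read `(a+b+c)² = 0`. If all three norms vanish, so does the diagonal. -/
theorem trace_eq_zero_of_mul_self_eq_zero {a b c : ℂ} {x y z : OctonionC}
    (h : hermMatrix a b c x y z * hermMatrix a b c x y z = 0) : a + b + c = 0 := by
  obtain ⟨ha, hb, hc, hx, hy, hz⟩ := hermMatrix_mul_self_eq_zero h
  have h1 := smul_normSq_eq hx
  have h2 := smul_normSq_eq hy
  have h3 := smul_normSq_eq hz
  have n1 : (b + c) ^ 2 * normSq x = normSq y * normSq z := by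
    rw [← normSq_smul, eq_neg_of_add_eq_zero_left hx, normSq_neg, normSq_star, normSq_mul]
  have n2 : (c + a) ^ 2 * normSq y = normSq z * normSq x := by
    rw [← normSq_smul, eq_neg_of_add_eq_zero_left hy, normSq_neg, normSq_star, normSq_mul]
  have n3 : (a + b) ^ 2 * normSq z = normSq x * normSq y := by
    rw [← normSq_smul, eq_neg_of_add_eq_zero_left hz, normSq_neg, normSq_star, normSq_mul]
  rw [← re_mul_assoc, re_mul_comm] at h2
  rw [← re_mul_assoc, re_mul_comm, ← re_mul_assoc, re_mul_comm] at h3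
  by_contra ht
  have hx0 : normSq x = 0 := by
    by_contra h0
    have h4 : normSq y = (a + b) * (b + c) :=
      mul_left_cancel₀ h0 (by linear_combination -n3 + (a + b) * (h3 - h1))
    exact ht (pow_eq_zero_iff two_ne_zero |>.1 (by linear_combination hc + ha - hb - 2 * h4))
  have hy0 : normSq y = 0 := by
    by_contra h0
    have h4 : normSq z = (b + c) * (c + a) :=
      mul_left_cancel₀ h0 (by linear_combination -n1 + (b + c) * (h1 - h2))
    exact ht (pow_eq_zero_iff two_ne_zero |>.1 (by linear_combination ha + hb - hc - 2 * h4))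
  have hz0 : normSq z = 0 := by
    by_contra h0
    have h4 : normSq x = (c + a) * (a + b) :=
      mul_left_cancel₀ h0 (by linear_combination -n2 + (c + a) * (h2 - h3))
    exact ht (pow_eq_zero_iff two_ne_zero |>.1 (by linear_combination hb + hc - ha - 2 * h4))
  simp only [hx0, hy0, hz0, add_zero, pow_eq_zero_iff two_ne_zero] at ha hb hc
  exact ht (by rw [ha, hb, hc]; simp)

theorem map_mem_coneOP {g : Herm3 ≃ₗ[ℂ] Herm3} (hg : g ∈ F4) {A : Herm3} (hA : A ∈ coneOP) :
    g A ∈ coneOP := by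
  have hsq : jordanMul (g A) (g A) = 0 := by
    rw [← hg A A, show jordanMul A A = 0 from Subtype.ext ((jordanMul_self_val A).trans hA.1),
      map_zero]
  have hne : g A ≠ 0 := by simpa using hA.2.2
  have hsq' : (g A : Matrix (Fin 3) (Fin 3) OctonionC) * g A = 0 := by
    rw [← jordanMul_self_val, hsq]
    rfl
  obtain ⟨a, b, c, x, y, z, h⟩ := exists_eq_herm (g A)
  rw [h] at hsq' hne ⊢
  exact herm_mem_coneOP.2 ⟨hsq', trace_eq_zero_of_mul_self_eq_zero hsq', hne⟩

/-! ### Orbits -/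

/-- Two elements of `Herm3` are related if they lie in the same `F4`-orbit. -/
def SameOrbit (A B : Herm3) : Prop := ∃ g ∈ F4, g A = B

theorem SameOrbit.refl (A : Herm3) : SameOrbit A A := ⟨1, F4.one_mem, rfl⟩

theorem SameOrbit.trans {A B C : Herm3} : SameOrbit A B → SameOrbit B C → SameOrbit A C := by
  rintro ⟨g, hg, rfl⟩ ⟨h, hh, rfl⟩
  exact ⟨h * g, F4.mul_mem hh hg, rfl⟩

theorem SameOrbit.symm {A B : Herm3} : SameOrbit A B → SameOrbit B A := by
  rintro ⟨g, hg, rfl⟩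
  exact ⟨g⁻¹, F4.inv_mem hg, g.symm_apply_apply A⟩

theorem SameOrbit.mem_coneOP {A B : Herm3} (h : SameOrbit A B) (hA : A ∈ coneOP) :
    B ∈ coneOP := by
  obtain ⟨g, hg, rfl⟩ := h
  exact map_mem_coneOP hg hA

/-- The Jordan square of a hermitian matrix in coordinates. -/
theorem herm_square (a b c : ℂ) (x y z : OctonionC) :
    jordanMul (herm a b c x y z) (herm a b c x y z) =
      herm (a ^ 2 + normSq z + normSq y) (b ^ 2 + normSq x + normSq z)
        (c ^ 2 + normSq y + normSq x) ((b + c) • x + star (y * z)) ((c + a) • y + star (z * x))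
        ((a + b) • z + star (x * y)) :=
  Subtype.ext ((jordanMul_self_val _).trans (hermMatrix_mul_self a b c x y z))

/-! ### Twists by unit octonions -/

/-- Conjugation of a matrix by `diag (star u, u, 1)`. -/
def twistMatrix (u : OctonionC) :
    Matrix (Fin 3) (Fin 3) OctonionC →ₗ[ℂ] Matrix (Fin 3) (Fin 3) OctonionC where
  toFun M := !![M 0 0, (star u * M 0 1) * star u, star u * M 0 2;
    (u * M 1 0) * u, M 1 1, u * M 1 2; M 2 0 * u, M 2 1 * star u, M 2 2]
  map_add' M N := by
    ext1 i j
    fin_cases i <;> fin_cases j <;> simp [mul_add, add_mul]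
  map_smul' r M := by
    ext1 i j
    fin_cases i <;> fin_cases j <;> simp [mul_smul_comm, smul_mul_assoc]

theorem twistMatrix_hermMatrix (u : OctonionC) (a b c : ℂ) (x y z : OctonionC) :
    twistMatrix u (hermMatrix a b c x y z) =
      hermMatrix a b c (u * x) (y * u) ((star u * z) * star u) := by
  ext1 i j
  fin_cases i <;> fin_cases j <;> simp [twistMatrix, hermMatrix, mul_mul_self_comm]

/-- Conjugation by `diag (star u, u, 1)` on `Herm3`. -/
def twist (u : OctonionC) : Herm3 →ₗ[ℂ] Herm3 :=
  (twistMatrix u).restrict fun A hA => by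
    obtain ⟨a, b, c, x, y, z, h⟩ := exists_eq_herm ⟨A, hA⟩
    rw [show A = hermMatrix a b c x y z from congrArg Subtype.val h, twistMatrix_hermMatrix]
    exact hermMatrix_mem ..

theorem twist_herm (u : OctonionC) (a b c : ℂ) (x y z : OctonionC) :
    twist u (herm a b c x y z) = herm a b c (u * x) (y * u) ((star u * z) * star u) :=
  Subtype.ext (twistMatrix_hermMatrix u a b c x y z)

theorem mul_mul_star_mul_cancel {u : OctonionC} (hu : normSq u = 1) (x y : OctonionC) :
    ((u * x) * u) * (star u * y) = u * (x * y) := by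
  have h := star_mul_mul_cancel (star u) y
  rw [star_star, normSq_star, hu, one_smul] at h
  rw [moufang_left, h]

/-- Norms of entries are unchanged, so only the products of two off-diagonal entries matter. Each
transforms like the conjugate of the third entry: `xy` by the middle Moufang identity, `zx` and `yz`
by the left one and its mirror image. -/
theorem twist_square {u : OctonionC} (hu : normSq u = 1) (A : Herm3) :
    twist u (jordanMul A A) = jordanMul (twist u A) (twist u A) := by
  obtain ⟨a, b, c, x, y, z, rfl⟩ := exists_eq_herm A
  have h1 : (y * u) * ((star u * z) * star u) = (y * z) * star u := by
    apply star_injective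
    simpa [← mul_mul_self_comm] using mul_mul_star_mul_cancel hu (star z) (star y)
  have h2 : ((star u * z) * star u) * (u * x) = star u * (z * x) := by
    simpa using mul_mul_star_mul_cancel (u := star u) (by simpa using hu) z x
  have h3 : (u * x) * (y * u) = (u * (x * y)) * u := by
    rw [moufang_middle]
  simp only [herm_square, twist_herm, h1, h2, h3, normSq_mul, normSq_star, hu, one_mul, mul_one,
    star_mul, star_star, mul_add, add_mul, mul_smul_comm, smul_mul_assoc]
  simp only [mul_mul_self_comm]

theorem twist_star_twist {u : OctonionC} (hu : normSq u = 1) (A : Herm3) :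
    twist (star u) (twist u A) = A := by
  obtain ⟨a, b, c, x, y, z, rfl⟩ := exists_eq_herm A
  have h (w) : u * (star u * w) = w := by
    simpa [hu] using star_mul_mul_cancel (star u) w
  have h' (w) : (w * star u) * u = w := by
    simpa [hu] using mul_mul_star_cancel (star u) w
  simp [twist_herm, star_mul_mul_cancel, mul_mul_star_cancel, hu, mul_mul_self_comm, h, h']

theorem sameOrbit_twist {u : OctonionC} (hu : normSq u = 1) (a b c : ℂ) (x y z : OctonionC) :
    SameOrbit (herm a b c x y z) (herm a b c (u * x) (y * u) ((star u * z) * star u)) := by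
  obtain ⟨g, hg, h⟩ := exists_mem_F4 (twist u) (twist (star u)) (twist_star_twist hu)
    (by simpa using twist_star_twist (u := star u) (by simpa using hu)) (twist_square hu)
  exact ⟨g, hg, by rw [h, twist_herm]⟩

/-! ### Congruence by complex orthogonal matrices -/

/-- The congruence `A ↦ P A Pᵀ` of an octonionic matrix by a complex matrix. -/
def congruenceMatrix (P : Matrix (Fin 3) (Fin 3) ℂ) :
    Matrix (Fin 3) (Fin 3) OctonionC →ₗ[ℂ] Matrix (Fin 3) (Fin 3) OctonionC where
  toFun M := Matrix.of fun i j => ∑ k, ∑ l, (P i k * P j l) • M k l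
  map_add' M N := by
    ext1 i j
    simp [Finset.sum_add_distrib]
  map_smul' r M := by
    ext1 i j
    simp only [Matrix.of_apply, Matrix.smul_apply, Finset.smul_sum, RingHom.id_apply,
      smul_comm r]

theorem congruenceMatrix_apply (P : Matrix (Fin 3) (Fin 3) ℂ)
    (M : Matrix (Fin 3) (Fin 3) OctonionC) (i j : Fin 3) :
    congruenceMatrix P M i j = ∑ k, ∑ l, (P i k * P j l) • M k l := rfl

/-- The congruence `A ↦ P A Pᵀ` on `Herm3`. -/
def congruence (P : Matrix (Fin 3) (Fin 3) ℂ) : Herm3 →ₗ[ℂ] Herm3 :=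
  (congruenceMatrix P).restrict fun A hA => by
    have h : ∀ i j, star (A j i) = A i j := fun i j =>
      congrFun (congrFun (show Aᴴ = A from hA) i) j
    change (_ : Matrix (Fin 3) (Fin 3) OctonionC)ᴴ = _
    ext1 i j
    simp only [Matrix.conjTranspose_apply, congruenceMatrix_apply, star_sum,
      Octonion.star_smul', h]
    rw [Finset.sum_comm]
    simp only [mul_comm]

theorem congruence_val (P : Matrix (Fin 3) (Fin 3) ℂ) (A : Herm3) :
    (congruence P A : Matrix (Fin 3) (Fin 3) OctonionC) = congruenceMatrix P A.1 := rfl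

theorem congruenceMatrix_comp (P Q : Matrix (Fin 3) (Fin 3) ℂ)
    (M : Matrix (Fin 3) (Fin 3) OctonionC) :
    congruenceMatrix P (congruenceMatrix Q M) = congruenceMatrix (P * Q) M := by
  ext1 i j
  simp only [congruenceMatrix_apply, Matrix.mul_apply, Fin.sum_univ_three]
  module

theorem congruenceMatrix_one (M : Matrix (Fin 3) (Fin 3) OctonionC) :
    congruenceMatrix 1 M = M := by
  ext1 i j
  simp [congruenceMatrix_apply, Matrix.one_apply, ite_smul]

theorem sum_smul_mul_sum_smul {P : Matrix (Fin 3) (Fin 3) ℂ} (hP : Pᵀ * P = 1)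
    (v w : Fin 3 → OctonionC) :
    ∑ j, (∑ m, P j m • v m) * (∑ n, P j n • w n) = ∑ m, v m * w m := by
  have h : ∀ l m, ∑ j, P j l * P j m = if l = m then 1 else 0 := fun l m => by
    simpa [Matrix.mul_apply, Matrix.one_apply] using congrFun (congrFun hP l) m
  calc ∑ j, (∑ m, P j m • v m) * (∑ n, P j n • w n)
      = ∑ j, ∑ m, ∑ n, (P j m * P j n) • (v m * w n) := by
        simp only [Finset.sum_mul, Finset.mul_sum, Finset.smul_sum, smul_mul_assoc, mul_smul_comm,
          smul_smul]
        refine Finset.sum_congr rfl fun j _ => ?_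
        rw [Finset.sum_comm]
        simp only [mul_comm]
    _ = ∑ m, ∑ n, (∑ j, P j m * P j n) • (v m * w n) := by
        rw [Finset.sum_comm]
        refine Finset.sum_congr rfl fun m _ => ?_
        rw [Finset.sum_comm]
        simp only [Finset.sum_smul]
    _ = ∑ m, v m * w m := by simp [h]

theorem congruenceMatrix_mul {P : Matrix (Fin 3) (Fin 3) ℂ} (hP : Pᵀ * P = 1)
    (M N : Matrix (Fin 3) (Fin 3) OctonionC) :
    congruenceMatrix P (M * N) = congruenceMatrix P M * congruenceMatrix P N := by
  ext1 i r
  have h₁ : ∀ j, congruenceMatrix P M i j = ∑ m, P j m • ∑ k, P i k • M k m := fun j => by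
    rw [congruenceMatrix_apply, Finset.sum_comm]
    simp only [Finset.smul_sum, smul_smul, mul_comm]
  have h₂ : ∀ j, congruenceMatrix P N j r = ∑ n, P j n • ∑ l, P r l • N n l := fun j => by
    simp only [congruenceMatrix_apply, Finset.smul_sum, smul_smul]
  simp only [Matrix.mul_apply, h₁, h₂]
  rw [sum_smul_mul_sum_smul hP]
  simp only [congruenceMatrix_apply, Matrix.mul_apply, Finset.sum_mul, Finset.mul_sum,
    smul_mul_assoc, mul_smul_comm, smul_smul, Finset.smul_sum]
  rw [Finset.sum_comm]
  simp only [Fin.sum_univ_three, mul_comm (P r _)]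
  abel

theorem sameOrbit_congruence {P : Matrix (Fin 3) (Fin 3) ℂ} (hP : P * Pᵀ = 1) (A : Herm3) :
    SameOrbit A (congruence P A) := by
  have hP' : Pᵀ * P = 1 := mul_eq_one_comm.1 hP
  obtain ⟨g, hg, h⟩ := exists_mem_F4 (congruence P) (congruence Pᵀ)
    (fun A => Subtype.ext (by
      simp only [congruence_val, congruenceMatrix_comp, hP', congruenceMatrix_one]))
    (fun A => Subtype.ext (by
      simp only [congruence_val, congruenceMatrix_comp, hP, congruenceMatrix_one]))
    (fun A => Subtype.ext (by
      simp only [congruence_val, jordanMul_self_val, congruenceMatrix_mul hP']))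
  exact ⟨g, hg, h A⟩

theorem sameOrbit_cycle (a b c : ℂ) (x y z : OctonionC) :
    SameOrbit (herm a b c x y z) (herm b c a y z x) := by
  have hP : (!![0, 1, 0; 0, 0, 1; 1, 0, 0] : Matrix (Fin 3) (Fin 3) ℂ) *
      (!![0, 1, 0; 0, 0, 1; 1, 0, 0] : Matrix (Fin 3) (Fin 3) ℂ)ᵀ = 1 := by
    ext i j
    fin_cases i <;> fin_cases j <;> simp [Matrix.mul_apply, Fin.sum_univ_three]
  convert sameOrbit_congruence hP (herm a b c x y z)
  apply Subtype.ext
  ext1 i j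
  rw [congruence_val, congruenceMatrix_apply]
  fin_cases i <;> fin_cases j <;> simp [herm, hermMatrix, Fin.sum_univ_three]

/-- A rotation in the plane of the first two coordinates. -/
theorem exists_sameOrbit_rotation {p q : ℂ} (h : p ^ 2 + q ^ 2 = 1) (a b c : ℂ)
    (x y z : OctonionC) :
    ∃ x' y' z', SameOrbit (herm a b c x y z)
      (herm (p ^ 2 * a + q ^ 2 * b + 2 * p * q * z.re) (q ^ 2 * a + p ^ 2 * b - 2 * p * q * z.re) c
        x' y' z') := by
  have hP : (!![p, q, 0; -q, p, 0; 0, 0, 1] : Matrix (Fin 3) (Fin 3) ℂ) *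
      (!![p, q, 0; -q, p, 0; 0, 0, 1] : Matrix (Fin 3) (Fin 3) ℂ)ᵀ = 1 := by
    ext i j
    fin_cases i <;> fin_cases j <;> simp [Matrix.mul_apply, Fin.sum_univ_three] <;>
      first | linear_combination h | ring
  have ho := sameOrbit_congruence hP (herm a b c x y z)
  set P : Matrix (Fin 3) (Fin 3) ℂ := !![p, q, 0; -q, p, 0; 0, 0, 1] with hPdef
  obtain ⟨a', b', c', x', y', z', h'⟩ := exists_eq_herm (congruence P (herm a b c x y z))
  have hd (i) : re ((congruence P (herm a b c x y z)).1 i i) =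
      re ((herm a' b' c' x' y' z').1 i i) := congrArg (fun A : Herm3 => re (A.1 i i)) h'
  simp only [congruence_val, congruenceMatrix_apply, Fin.sum_univ_three] at hd
  have h0 := hd 0
  have h1 := hd 1
  have h2 := hd 2
  simp [herm, hermMatrix, hPdef] at h0 h1 h2
  refine ⟨x', y', z', ?_⟩
  convert ho using 1
  rw [h', ← h0, ← h1, ← h2]
  congr 1 <;> ring

/-! ### Making the diagonal nonzero -/

theorem Octonion.re_mul (x y : OctonionC) : (x * y).re =
    x.fst.re * y.fst.re - x.fst.imI * y.fst.imI - x.fst.imJ * y.fst.imJ - x.fst.imK * y.fst.imK -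
      (x.snd.re * y.snd.re + x.snd.imI * y.snd.imI + x.snd.imJ * y.snd.imJ +
        x.snd.imK * y.snd.imK) := by
  simp [re]
  ring

/-- The eight basis units have norm 1, and the real parts of their products with `x` are its
coordinates up to sign. -/
theorem exists_unit_re_mul_ne_zero {x : OctonionC} (hx : x ≠ 0) :
    ∃ u : OctonionC, normSq u = 1 ∧ (u * x).re ≠ 0 := by
  by_contra! h
  apply hx
  apply ext_components
  · simpa [Octonion.re_mul, normSq] using h ⟨⟨1, 0, 0, 0⟩, 0⟩
  · simpa [Octonion.re_mul, normSq] using h ⟨⟨0, 1, 0, 0⟩, 0⟩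
  · simpa [Octonion.re_mul, normSq] using h ⟨⟨0, 0, 1, 0⟩, 0⟩
  · simpa [Octonion.re_mul, normSq] using h ⟨⟨0, 0, 0, 1⟩, 0⟩
  · simpa [Octonion.re_mul, normSq] using h ⟨0, ⟨1, 0, 0, 0⟩⟩
  · simpa [Octonion.re_mul, normSq] using h ⟨0, ⟨0, 1, 0, 0⟩⟩
  · simpa [Octonion.re_mul, normSq] using h ⟨0, ⟨0, 0, 1, 0⟩⟩
  · simpa [Octonion.re_mul, normSq] using h ⟨0, ⟨0, 0, 0, 1⟩⟩

theorem herm_ne_zero {a b c : ℂ} {x y z : OctonionC} (h : herm a b c x y z ≠ 0) :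
    (a ≠ 0 ∨ b ≠ 0 ∨ c ≠ 0) ∨ x ≠ 0 ∨ y ≠ 0 ∨ z ≠ 0 := by
  contrapose! h
  obtain ⟨⟨rfl, rfl, rfl⟩, rfl, rfl, rfl⟩ := h
  exact Subtype.ext hermMatrix_zero

theorem exists_sameOrbit_diag_ne_zero {A : Herm3} (hA : A ≠ 0) :
    ∃ a b c x y z, SameOrbit A (herm a b c x y z) ∧ a ≠ 0 := by
  obtain ⟨a, b, c, x, y, z, rfl⟩ := exists_eq_herm A
  have hc := sameOrbit_cycle a b c x y z
  have hcc := hc.trans (sameOrbit_cycle b c a y z x)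
  by_cases hd : a ≠ 0 ∨ b ≠ 0 ∨ c ≠ 0
  · obtain h | h | h := hd
    · exact ⟨_, _, _, _, _, _, .refl _, h⟩
    · exact ⟨_, _, _, _, _, _, hc, h⟩
    · exact ⟨_, _, _, _, _, _, hcc, h⟩
  have key : ∀ x y z : OctonionC, x ≠ 0 →
      ∃ a b c x' y' z', SameOrbit (herm 0 0 0 x y z) (herm a b c x' y' z') ∧ a ≠ 0 := by
    intro x y z hx
    obtain ⟨u, hu, hre⟩ := exists_unit_re_mul_ne_zero hx
    -- With zero diagonal, the first rotated entry is `2pq Re(ux)`, so any rotation with `pq ≠ 0`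
    -- would do.
    obtain ⟨x', y', z', h⟩ := exists_sameOrbit_rotation (p := 3 / 5) (q := 4 / 5) (by norm_num)
      0 0 0 (y * u) ((star u * z) * star u) (u * x)
    exact ⟨_, _, _, _, _, _, (sameOrbit_twist hu 0 0 0 x y z).trans
      ((sameOrbit_cycle _ _ _ _ _ _).trans h), by simpa using hre⟩
  have hne := (herm_ne_zero hA).resolve_left hd
  push Not at hd
  obtain ⟨rfl, rfl, rfl⟩ := hd
  obtain h | h | h := hne
  · exact key x y z h
  · obtain ⟨a, b, c, x', y', z', h1, h2⟩ := key y z x h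
    exact ⟨_, _, _, _, _, _, hc.trans h1, h2⟩
  · obtain ⟨a, b, c, x', y', z', h1, h2⟩ := key z x y h
    exact ⟨_, _, _, _, _, _, hcc.trans h1, h2⟩

theorem exists_sameOrbit_all_diag_ne_zero {A : Herm3} (hA : A ∈ coneOP) :
    ∃ a b c x y z, SameOrbit A (herm a b c x y z) ∧ a ≠ 0 ∧ b ≠ 0 ∧ c ≠ 0 := by
  have key : ∀ a (x y z : OctonionC), a ≠ 0 → ∃ a' b' c' x' y' z',
      SameOrbit (herm a 0 (-a) x y z) (herm a' b' c' x' y' z') ∧ a' ≠ 0 ∧ b' ≠ 0 ∧ c' ≠ 0 := by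
    intro a x y z ha
    -- Up to nonzero factors these are the first two diagonal entries after rotation by `(3/5,
    -- 4/5)`. If one vanishes, `z.re` is a fixed multiple of `a`, and the rotation by `(3/5, -4/5)`
    -- leaves both nonzero.
    by_cases hr : 3 * a + 8 * z.re = 0 ∨ 2 * a - 3 * z.re = 0
    · obtain ⟨x', y', z', h⟩ := exists_sameOrbit_rotation (p := 3 / 5) (q := -4 / 5) (by norm_num)
        a 0 (-a) x y z
      refine ⟨_, _, _, _, _, _, h, ?_, ?_, neg_ne_zero.2 ha⟩
      · intro h0
        apply ha
        obtain hr | hr := hr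
        · linear_combination (25 / 18 : ℂ) * h0 + (1 / 6 : ℂ) * hr
        · linear_combination (-25 / 7 : ℂ) * h0 + (8 / 7 : ℂ) * hr
      · intro h0
        apply ha
        obtain hr | hr := hr
        · linear_combination (25 / 7 : ℂ) * h0 - (3 / 7 : ℂ) * hr
        · linear_combination (25 / 32 : ℂ) * h0 + (1 / 4 : ℂ) * hr
    · push Not at hr
      obtain ⟨x', y', z', h⟩ := exists_sameOrbit_rotation (p := 3 / 5) (q := 4 / 5) (by norm_num)
        a 0 (-a) x y z
      refine ⟨_, _, _, _, _, _, h, ?_, ?_, neg_ne_zero.2 ha⟩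
      · exact fun h0 => hr.1 (by linear_combination (25 / 3 : ℂ) * h0)
      · exact fun h0 => hr.2 (by linear_combination (25 / 8 : ℂ) * h0)
  obtain ⟨a, b, c, x, y, z, h, ha⟩ := exists_sameOrbit_diag_ne_zero hA.2.2
  have ht := (herm_mem_coneOP.1 (h.mem_coneOP hA)).2.1
  by_cases hb : b = 0
  · subst hb
    obtain rfl : c = -a := by linear_combination ht
    obtain ⟨a', b', c', x', y', z', h', h0⟩ := key a x y z ha
    exact ⟨_, _, _, _, _, _, h.trans h', h0⟩
  by_cases hc : c = 0
  · subst hc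
    obtain rfl : a = -b := by linear_combination ht
    obtain ⟨a', b', c', x', y', z', h', h0⟩ := key b y z x hb
    exact ⟨_, _, _, _, _, _, (h.trans (sameOrbit_cycle _ _ _ _ _ _)).trans h', h0⟩
  exact ⟨_, _, _, _, _, _, h, ha, hb, hc⟩

/-! ### Making all entries complex scalars -/

/-- The norms and products of the entries of an element of the cone. -/
theorem entries_of_mem_coneOP {a b c : ℂ} {x y z : OctonionC} (h : herm a b c x y z ∈ coneOP) :
    normSq x = b * c ∧ normSq y = c * a ∧ normSq z = a * b ∧ a • x = star (y * z) ∧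
      b • y = star (z * x) ∧ c • z = star (x * y) := by
  obtain ⟨h2, ht, -⟩ := herm_mem_coneOP.1 h
  obtain ⟨ha, hb, hc, hx, hy, hz⟩ := hermMatrix_mul_self_eq_zero h2
  obtain rfl : a = -(b + c) := by linear_combination ht
  refine ⟨by linear_combination (hb + hc - ha) / 2, by linear_combination (ha + hc - hb) / 2,
    by linear_combination (ha + hb - hc) / 2, ?_, ?_, ?_⟩
  · rw [eq_neg_of_add_eq_zero_right hx]; module
  · rw [eq_neg_of_add_eq_zero_right hy]; module
  · rw [eq_neg_of_add_eq_zero_right hz]; module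

/-- An imaginary unit octonion orthogonal to the conjugate of a given octonion. -/
theorem exists_imaginary_unit (y : OctonionC) :
    ∃ u : OctonionC, normSq u = 1 ∧ u.re = 0 ∧ (y * u).re = 0 := by
  have key : ∀ v : OctonionC, normSq v ≠ 0 → v.re = 0 → (y * v).re = 0 →
      ∃ u : OctonionC, normSq u = 1 ∧ u.re = 0 ∧ (y * u).re = 0 := by
    intro v hv h1 h2
    obtain ⟨s, hs⟩ := IsAlgClosed.exists_pow_nat_eq (normSq v)⁻¹ two_pos
    refine ⟨s • v, ?_, by simp [h1], by simp [mul_smul_comm, h2]⟩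
    rw [normSq_smul, hs, inv_mul_cancel₀ hv]
  -- The three test vectors are orthogonal to the conjugate of `y`. If all are isotropic, the
  -- squares of the quaternionic imaginary coordinates of `y` sum pairwise to zero, so `imI`
  -- vanishes and the unit `i` works.
  by_contra hn
  have e1 : y.fst.imJ ^ 2 + y.fst.imI ^ 2 = 0 := by
    by_contra h0
    exact hn (key ⟨⟨0, y.fst.imJ, -y.fst.imI, 0⟩, 0⟩ (by simpa [normSq] using h0)
      (by simp [re]) (by simp [Octonion.re_mul]; ring))
  have e2 : y.fst.imK ^ 2 + y.fst.imJ ^ 2 = 0 := by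
    by_contra h0
    exact hn (key ⟨⟨0, 0, y.fst.imK, -y.fst.imJ⟩, 0⟩ (by simpa [normSq] using h0)
      (by simp [re]) (by simp [Octonion.re_mul]; ring))
  have e3 : y.fst.imK ^ 2 + y.fst.imI ^ 2 = 0 := by
    by_contra h0
    exact hn (key ⟨⟨0, y.fst.imK, 0, -y.fst.imI⟩, 0⟩ (by simpa [normSq] using h0)
      (by simp [re]) (by simp [Octonion.re_mul]; ring))
  have e4 : y.fst.imI = 0 := by
    rw [← pow_eq_zero_iff two_ne_zero]
    linear_combination (e1 - e2 + e3) / 2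
  exact hn (key ⟨⟨0, 1, 0, 0⟩, 0⟩ (by simp [normSq]) (by simp [re])
    (by simp [Octonion.re_mul, e4]))

theorem star_eq_neg_of_re_eq_zero {u : OctonionC} (h : u.re = 0) : star u = -u := by
  have h' : u.fst.re = 0 := h
  apply ext_components <;> simp [h']

theorem star_mul_star_of_imaginary {u : OctonionC} (hn : normSq u = 1) (h : u.re = 0) :
    star u * star u = -1 := by
  have := star_mul_self' u
  rw [hn, one_smul] at this
  conv_lhs => rw [star_eq_neg_of_re_eq_zero h, neg_mul_neg]
  rw [← this, star_eq_neg_of_re_eq_zero h, neg_mul, neg_neg]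

/-- An imaginary unit squares to `-1`, so its twist keeps a scalar third entry scalar, leaving
freedom to adjust the other two. -/
theorem sameOrbit_twist_imaginary {u : OctonionC} (hn : normSq u = 1) (h : u.re = 0)
    (a b c r : ℂ) (x y : OctonionC) :
    SameOrbit (herm a b c x y (r • 1)) (herm a b c (u * x) (y * u) ((-r) • 1)) := by
  convert sameOrbit_twist hn a b c x y (r • 1) using 2
  rw [mul_smul_comm, mul_one, smul_mul_assoc, star_mul_star_of_imaginary hn h]
  simp

/-- Twist first by an imaginary `u` making `yu` imaginary, then by the normalized conjugate of `yu`: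
both twists are imaginary, and `y` becomes scalar. The relation `a x = star (y z)` with `a ≠ 0`
makes `x` scalar too. -/
theorem exists_sameOrbit_scalar_of_scalar_entry {a b c r : ℂ} {x y : OctonionC}
    (hA : herm a b c x y (r • 1) ∈ coneOP) (ha : a ≠ 0) (hc : c ≠ 0) :
    ∃ p q r' : ℂ,
      SameOrbit (herm a b c x y (r • 1)) (herm a b c (p • 1) (q • 1) (r' • 1)) := by
  obtain ⟨u, hu, hu0, huy⟩ := exists_imaginary_unit y
  have hy : normSq (y * u) ≠ 0 := by
    rw [normSq_mul, hu, (entries_of_mem_coneOP hA).2.1, mul_one]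
    exact mul_ne_zero hc ha
  obtain ⟨t, ht⟩ := IsAlgClosed.exists_pow_nat_eq (normSq (y * u))⁻¹ two_pos
  have ht' : normSq (t • star (y * u)) = 1 := by
    rw [normSq_smul, normSq_star, ht, inv_mul_cancel₀ hy]
  have h := (sameOrbit_twist_imaginary hu hu0 a b c r x y).trans
    (sameOrbit_twist_imaginary ht' (by rw [re_smul, re_star, huy, mul_zero]) a b c (-r) _ _)
  rw [mul_smul_comm, mul_star_self', smul_smul] at h
  have hx := (entries_of_mem_coneOP (h.mem_coneOP hA)).2.2.2.1
  rw [smul_mul_smul_comm, one_mul, Octonion.star_smul', star_one] at hx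
  rw [(eq_inv_smul_iff₀ ha).2 hx, smul_smul] at h
  exact ⟨_, _, _, h⟩

theorem exists_sameOrbit_scalar {A : Herm3} (hA : A ∈ coneOP) :
    ∃ a b c p q r : ℂ, SameOrbit A (herm a b c (p • 1) (q • 1) (r • 1)) ∧ a ≠ 0 ∧ c ≠ 0 := by
  -- The names anticipate the cyclic shift, which brings the entry made scalar into third position.
  obtain ⟨c, a, b, z, x, y, h, hc, ha, hb⟩ := exists_sameOrbit_all_diag_ne_zero hA
  have hz : normSq z ≠ 0 := by
    rw [(entries_of_mem_coneOP (h.mem_coneOP hA)).1]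
    exact mul_ne_zero ha hb
  obtain ⟨t, ht⟩ := IsAlgClosed.exists_pow_nat_eq (normSq z)⁻¹ two_pos
  have ht' : normSq (t • star z) = 1 := by
    rw [normSq_smul, normSq_star, ht, inv_mul_cancel₀ hz]
  have h1 := (h.trans (sameOrbit_twist ht' _ _ _ _ _ _)).trans (sameOrbit_cycle _ _ _ _ _ _)
  rw [smul_mul_assoc, star_mul_self', smul_smul] at h1
  obtain ⟨p, q, r, h2⟩ := exists_sameOrbit_scalar_of_scalar_entry (h1.mem_coneOP hA) ha hc
  exact ⟨_, _, _, _, _, _, h1.trans h2, ha, hc⟩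

/-! ### Isotropic vectors and the canonical element -/

/-- A complex isotropic vector is moved by a reflection to any isotropic vector that is not
orthogonal to it. -/
theorem exists_orthogonal_mulVec_eq {v w : Fin 3 → ℂ} (hv : v ⬝ᵥ v = 0) (hw : w ⬝ᵥ w = 0)
    (h : v ⬝ᵥ w ≠ 0) : ∃ P : Matrix (Fin 3) (Fin 3) ℂ, P * Pᵀ = 1 ∧ P *ᵥ v = w := by
  have hwv : w ⬝ᵥ v = v ⬝ᵥ w := dotProduct_comm _ _
  have hd : (v - w) ⬝ᵥ (v - w) = -2 * (v ⬝ᵥ w) := by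
    simp only [sub_dotProduct, dotProduct_sub, hv, hw, hwv]
    ring
  -- The reflection along `v - w`, whose square length is `-2 (v ⬝ᵥ w)`.
  refine ⟨1 + (v ⬝ᵥ w)⁻¹ • Matrix.vecMulVec (v - w) (v - w), ?_, ?_⟩
  · simp only [Matrix.transpose_add, Matrix.transpose_one, Matrix.transpose_smul,
      Matrix.transpose_vecMulVec, mul_add, add_mul, mul_one, one_mul, Matrix.smul_mul,
      Matrix.mul_smul, Matrix.vecMulVec_mul_vecMulVec, hd]
    ext i j
    simp [Matrix.vecMulVec_apply]
    field_simp
    ring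
  · simp only [Matrix.add_mulVec, Matrix.one_mulVec, Matrix.smul_mulVec, Matrix.vecMulVec_mulVec,
      sub_dotProduct, hv, hwv]
    ext i
    simp
    field_simp
    ring

theorem sameOrbit_canonicalElement_of_scalar {a b c p q r : ℂ}
    (hA : herm a b c (p • 1) (q • 1) (r • 1) ∈ coneOP) (ha : a ≠ 0) (hc : c ≠ 0) :
    SameOrbit (herm a b c (p • 1) (q • 1) (r • 1)) canonicalElement := by
  obtain ⟨hx, hy, hz, hax, -, -⟩ := entries_of_mem_coneOP hA
  have hap : a * p = q * r := by
    have := congrArg re hax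
    simpa [smul_mul_smul_comm, mul_comm q] using this
  simp only [normSq_smul, normSq_one, mul_one] at hx hy hz
  have ht := (herm_mem_coneOP.1 hA).2.1
  obtain ⟨α, hα⟩ := IsAlgClosed.exists_pow_nat_eq a two_pos
  obtain ⟨μ, hμ⟩ := IsAlgClosed.exists_pow_nat_eq Complex.I two_pos
  have hα0 : α ≠ 0 := by
    rintro rfl
    exact ha (by rw [← hα]; simp)
  have hμ0 : μ ≠ 0 := by
    rintro rfl
    exact Complex.I_ne_zero (by rw [← hμ]; simp)
  have hI := Complex.I_sq
  -- The first row divided by `α`, a square root of `a`; the relations among the entries make the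
  -- matrix `v vᵀ`, so `v ⬝ᵥ v` is its trace.
  set v : Fin 3 → ℂ := ![α, r / α, q / α] with hvdef
  -- Since `μ² = i`, the canonical matrix is `w wᵀ`.
  set w : Fin 3 → ℂ := ![μ, -Complex.I * μ, 0] with hwdef
  have hrr : (r / α) * (r / α) = b := by
    rw [← sq, div_pow, hz, hα, mul_div_cancel_left₀ _ ha]
  have hqq : (q / α) * (q / α) = c := by
    rw [← sq, div_pow, hy, hα, mul_div_cancel_right₀ _ ha]
  have hqr : (q / α) * (r / α) = p := by
    rw [div_mul_div_comm, ← hap, ← sq, hα, mul_div_cancel_left₀ _ ha]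
  have hαα : α * α = a := by rw [← sq, hα]
  have hαr : α * (r / α) = r := mul_div_cancel₀ _ hα0
  have hαq : α * (q / α) = q := mul_div_cancel₀ _ hα0
  have hv : v ⬝ᵥ v = 0 := by
    simp only [dotProduct, Fin.sum_univ_three, hvdef]
    simp only [Matrix.cons_val]
    linear_combination ht + hα + hrr + hqq
  have hw : w ⬝ᵥ w = 0 := by
    simp only [dotProduct, Fin.sum_univ_three, hwdef]
    simp only [Matrix.cons_val]
    linear_combination μ ^ 2 * hI
  have hvw : v ⬝ᵥ w ≠ 0 := by
    simp only [dotProduct, Fin.sum_univ_three, hwdef, hvdef]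
    simp only [Matrix.cons_val]
    intro h0
    -- Orthogonality of `v` and `w` would give `a + b = 0`, hence `c = 0` by the trace; this is
    -- where `c ≠ 0` enters.
    have h1 : α = Complex.I * (r / α) :=
      mul_left_cancel₀ hμ0 (by linear_combination h0)
    apply hc
    linear_combination ht + hα + hrr - (α + Complex.I * (r / α)) * h1 - (r / α) ^ 2 * hI
  obtain ⟨P, hP, hPv⟩ := exists_orthogonal_mulVec_eq hv hw hvw
  convert sameOrbit_congruence hP (herm a b c (p • 1) (q • 1) (r • 1))
  apply Subtype.ext
  have hM : (herm a b c (p • 1) (q • 1) (r • 1)).1 =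
      Matrix.of fun i j => (v i * v j) • (1 : OctonionC) := by
    ext1 i j
    fin_cases i <;> fin_cases j <;> simp only [herm, hermMatrix, hvdef, Octonion.star_smul',
      Matrix.of_apply, Matrix.cons_val, star_one, Fin.mk_one, Fin.zero_eta, Fin.reduceFinMk,
      hαα, hαr, hαq, mul_comm (r / α) α, mul_comm (q / α) α, hrr, hqq, hqr,
      mul_comm (r / α) (q / α)]
  have hμμ : μ * μ = Complex.I := by rw [← sq, hμ]
  have hμ₁ : μ * (Complex.I * μ) = -1 := by linear_combination Complex.I * hμ + hI
  have hμ₂ : Complex.I * μ * μ = -1 := by linear_combination Complex.I * hμ + hI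
  have hμ₃ : Complex.I * μ * (Complex.I * μ) = -Complex.I := by
    linear_combination Complex.I ^ 2 * hμ + Complex.I * hI
  have hC : (canonicalElement).1 = Matrix.of fun i j => (w i * w j) • (1 : OctonionC) := by
    ext1 i j
    fin_cases i <;> fin_cases j <;> simp [canonicalElement, hwdef, hμμ, hμ₁, hμ₂, hμ₃]
  rw [congruence_val, hM, hC, ← hPv]
  ext1 i j
  simp only [congruenceMatrix_apply, Matrix.of_apply, Matrix.mulVec, dotProduct, smul_smul,
    Fin.sum_univ_three]
  module

theorem canonicalElement_mem_coneOP : canonicalElement ∈ coneOP := by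
  have h : canonicalElement = herm Complex.I (-Complex.I) 0 0 0 1 := by
    apply Subtype.ext
    ext1 i j
    fin_cases i <;> fin_cases j <;> simp [canonicalElement, herm, hermMatrix]
  rw [h, herm_mem_coneOP, hermMatrix_mul_self]
  refine ⟨?_, by ring, fun h0 => ?_⟩
  · rw [← hermMatrix_zero]
    simp [normSq]
  · have h1 : herm Complex.I (-Complex.I) 0 0 0 1 = herm 0 0 0 0 0 0 :=
      h0.trans (Subtype.ext hermMatrix_zero).symm
    exact Complex.I_ne_zero (herm_injective h1).1

theorem sameOrbit_canonicalElement {A : Herm3} (hA : A ∈ coneOP) :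
    SameOrbit A canonicalElement := by
  obtain ⟨a, b, c, p, q, r, h, ha, hc⟩ := exists_sameOrbit_scalar hA
  exact h.trans (sameOrbit_canonicalElement_of_scalar (h.mem_coneOP hA) ha hc)

theorem mainTheorem1 :
    (∀ g ∈ F4, ∀ A ∈ coneOP, g A ∈ coneOP) ∧
    (∀ A ∈ coneOP, ∀ B ∈ coneOP, ∃ g ∈ F4, g A = B) ∧
    canonicalElement ∈ coneOP ∧
    (∀ A ∈ coneOP, ∃ g ∈ F4, g A = canonicalElement) :=
  ⟨fun _ hg _ hA => map_mem_coneOP hg hA,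
    fun _ hA _ hB => (sameOrbit_canonicalElement hA).trans (sameOrbit_canonicalElement hB).symm,
    canonicalElement_mem_coneOP, fun _ hA => sameOrbit_canonicalElement hA⟩
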